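/- Let $1<a<b<\kappa$ be real numbers, $I=[a,b]$, and for $n\in\mathbb N$ put $S_n=I\times\kappa^{-n}I$, $U_n=\kappa^{-n}I\times I\subset\mathbb R^2$. Let $H(x,y)=(\kappa^{-2}x,\kappa y)$ and $R(x,y)=(a+b-y,x)$. Let $f:\mathbb R^2\to\mathbb R^2$ be a $C^\infty$ diffeomorphism that equals the identity outside some ball centered at the origin, and let $n_0,k_0$ be positive integers such that (this is the figure-8 diffeomorphism of Guarino, Guihéneuf and Santiago): (a) there is a neighborhood $V$ of the origin with $\bigcup_{n\ge n_0}\bigcup_{0\le\ell\le n}f^\ell(S_n)\subset V$ and $f|_V=H|_V$; (b) the stable manifold $\{p: f^n(p)\to 0 \text{ as } n\to\infty\}$ and the unstable manifold $\{p: f^{-n}(p)\to 0\text{ as } n\to\infty\}$ of the origin coincide; (c) $f^{k_0}(U_n)=S_n$ for all $n\ge n_0$, and $f^{k_0}=R$ on $[0,\kappa^{-2n_0}]\times I$; (d) $f^{n+k_0}(x,y)=(a+b-\kappa^n y,\kappa^{-2n}x)\in S_{2n}$ for all $n\ge n_0$ and $(x,y)\in S_n$. For $j\ge n_0$ let $I_j:\mathbb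 R^2\to\mathbb R^2$ be given by $I_j(x,y)=(x,\kappa^{n-j}y)$ if $(x,y)\in S_n$ for some (necessarily unique) $n\ge n_0$, and $I_j(x,y)=(x,y)$ otherwise. Let $\Omega=\{n\in\mathbb N: n\ge n_0\}^{\mathbb N_0}$ carry the Bernoulli (infinite product) probability measure $\mathbb P$ with $\mathbb P(\omega_0=n)=p_n$, where $p_n\ge0$, $\sum_{n\ge n_0}p_n=1$ and $\sum_{n\ge n_0}n\,p_n<\infty$. For $\omega=(\omega_0,\omega_1,\dots)\in\Omega$ put $$f_\omega^n=(I_{\omega_{n-1}}\circ f)\circ\cdots\circ(I_{\omega_0}\circ f),\qquad f^0_\omega=\mathrm{id}.$$ Then for $\mathbb P$-almost every $\omega\in\Omega$, for every $m\ge n_0$, every $z\in S_m$ and every nonzero vector $v\in\mathbb R^2$, $$\lim_{n\to\infty}\frac1n\log\|Df_\omega^n(z)v\|=0 .$$ Here $Df^n_\omega(z)$ is the derivative at $z$ of the restriction of $f^n_\omega$ to the box $S_m$ (the ordinary derivative when $z$ is an interior point of $S_m$; $f_\omega^n$ may be discontinuous across the boundary of $S_m$), and it is part of the claim that this derivative exists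 and that $Df_\omega^n(z)v\ne0$ for all $n$. Consequently, for $\mathbb P$-almost every $\omega$, the set of points $z\in\bigcup_{m\ge n_0}S_m$ that are Lyapunov irregular for $(f^n_\omega)_n$ has zero Lebesgue measure. Here $z$ is Lyapunov regular if, for every nonzero $v$, all $f_\omega^n$ are differentiable at $z$ (as maps of the plane) with $Df_\omega^n(z)v\neq 0$ and $\lim_{n\to\infty}\frac1n\log\|Df_\omega^n(z)v\|$ exists in $\mathbb R$; otherwise it is Lyapunov irregular. -/

import Mathlib

open Set Filter Topology MeasureTheory
open scoped ENNReal

noncomputable section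

namespace FigureEight

/-- The plane `ℝ²` with the Euclidean norm and Lebesgue measure. -/
abbrev Plane : Type := EuclideanSpace ℝ (Fin 2)

/-- The box `S_n = I × κ^{-n} I`, where `I = [a, b]`. -/
def boxS (κ a b : ℝ) (n : ℕ) : Set Plane :=
  {p | p 0 ∈ Icc a b ∧ p 1 ∈ Icc (κ ^ (-(n : ℤ)) * a) (κ ^ (-(n : ℤ)) * b)}

/-- The box `U_n = κ^{-n} I × I`, where `I = [a, b]`. -/
def boxU (κ a b : ℝ) (n : ℕ) : Set Plane :=
  {p | p 0 ∈ Icc (κ ^ (-(n : ℤ)) * a) (κ ^ (-(n : ℤ)) * b) ∧ p 1 ∈ Icc a b}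

/-- The linear saddle `H(x, y) = (κ^{-2} x, κ y)`. -/
def saddle (κ : ℝ) (p : Plane) : Plane := !₂[κ ^ (-2 : ℤ) * p 0, κ * p 1]

/-- The rotation `R(x, y) = (a + b - y, x)` by `π/2` about `((a+b)/2, (a+b)/2)`. -/
def rot (a b : ℝ) (p : Plane) : Plane := !₂[a + b - p 1, p 0]

/-- `f` is a figure-8 type diffeomorphism of the plane, with parameters `κ`, `I = [a, b]`,
`n₀` and `k₀`. -/
structure IsFigureEightDiffeo (κ a b : ℝ) (n₀ k₀ : ℕ) (f : Plane ≃ Plane) : Prop where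
  /-- `f` is a `C^∞` diffeomorphism -/
  contDiff : ContDiff ℝ ((⊤ : ℕ∞) : WithTop ℕ∞) f
  contDiff_symm : ContDiff ℝ ((⊤ : ℕ∞) : WithTop ℕ∞) f.symm
  /-- `f` is the identity outside some ball centered at the origin -/
  compactly_supported : ∃ r : ℝ, ∀ p : Plane, r ≤ ‖p‖ → f p = p
  n₀_pos : 0 < n₀
  k₀_pos : 0 < k₀
  /-- on a neighborhood of the origin that contains `f^ℓ(S_n)` for `n ≥ n₀`, `0 ≤ ℓ ≤ n`,
  the map `f` is the linear saddle -/
  local_linear : ∃ V ∈ 𝓝 (0 : Plane),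
    (∀ n, n₀ ≤ n → ∀ l, l ≤ n → f^[l] '' boxS κ a b n ⊆ V) ∧ ∀ p ∈ V, f p = saddle κ p
  /-- the stable manifold of the origin coincides with its unstable manifold -/
  stable_eq_unstable :
    {p : Plane | Tendsto (fun n : ℕ => f^[n] p) atTop (𝓝 0)} =
      {p : Plane | Tendsto (fun n : ℕ => f.symm^[n] p) atTop (𝓝 0)}
  /-- `f^{k₀}` maps `U_n` onto `S_n` for `n ≥ n₀` -/
  image_boxU : ∀ n, n₀ ≤ n → f^[k₀] '' boxU κ a b n = boxS κ a b n
  /-- `f^{k₀}` is the rotation `R` on `[0, κ^{-2n₀}] × I` -/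
  eq_rot : ∀ p : Plane, p 0 ∈ Icc 0 (κ ^ (-(2 * n₀ : ℤ))) → p 1 ∈ Icc a b →
    f^[k₀] p = rot a b p
  /-- `f^{n + k₀}(x, y) = (a + b - κ^n y, κ^{-2n} x) ∈ S_{2n}` on `S_n`, for `n ≥ n₀` -/
  transition : ∀ n, n₀ ≤ n → ∀ p ∈ boxS κ a b n,
    f^[n + k₀] p = !₂[a + b - κ ^ n * p 1, κ ^ (-(2 * n : ℤ)) * p 0] ∧
      f^[n + k₀] p ∈ boxS κ a b (2 * n)

open Classical in
/-- The impulse `I_j`: on `S_n`, `n ≥ n₀`, it is `(x, y) ↦ (x, κ^{n - j} y)`, and it is the identity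
off these boxes. For `1 < a < b < κ` the boxes are disjoint, so `n` is determined by the point
(see `impulse_of_mem`). -/
def impulse (κ a b : ℝ) (n₀ j : ℕ) (p : Plane) : Plane :=
  if h : ∃ n, n₀ ≤ n ∧ p ∈ boxS κ a b n then
    !₂[p 0, κ ^ ((h.choose : ℤ) - (j : ℤ)) * p 1]
  else p

/-- A point lies in at most one of the boxes `S_n`. -/
theorem boxS_index_unique {κ a b : ℝ} (ha : 1 < a) (hb : b < κ)
    {m n : ℕ} {p : Plane} (hm : p ∈ boxS κ a b m) (hn : p ∈ boxS κ a b n) : m = n := by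
  have hab : a ≤ b := hm.1.1.trans hm.1.2
  have hκ : 1 < κ := by linarith
  have key : ∀ i j : ℕ, p ∈ boxS κ a b i → p ∈ boxS κ a b j → ¬ i < j := by
    intro i j hi hj hij
    have h1 := hi.2.1
    have h2 := hj.2.2
    have h3 : κ ^ (-(j : ℤ)) * κ ≤ κ ^ (-(i : ℤ)) := by
      rw [← zpow_add_one₀ (by linarith)]
      exact zpow_le_zpow_right₀ hκ.le (by omega)
    have hj0 : 0 < κ ^ (-(j : ℤ)) := by positivity
    have hi0 : 0 < κ ^ (-(i : ℤ)) := by positivity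
    nlinarith
  rcases lt_trichotomy m n with h | h | h
  · exact absurd h (key m n hm hn)
  · exact h
  · exact absurd h (key n m hn hm)

theorem impulse_of_mem {κ a b : ℝ} (ha : 1 < a) (hb : b < κ) {n₀ n : ℕ} (j : ℕ) (hn : n₀ ≤ n)
    {p : Plane} (hp : p ∈ boxS κ a b n) :
    impulse κ a b n₀ j p = !₂[p 0, κ ^ ((n : ℤ) - (j : ℤ)) * p 1] := by
  have h : ∃ n, n₀ ≤ n ∧ p ∈ boxS κ a b n := ⟨n, hn, hp⟩
  have e : h.choose = n := boxS_index_unique ha hb h.choose_spec.2 hp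
  rw [impulse, dif_pos h, e]

/-- The random iteration
`f_ω^n = (I_{ω_{n-1}} ∘ f) ∘ ⋯ ∘ (I_{ω_0} ∘ f)` for `ω ∈ {n | n ≥ n₀}^ℕ`. -/
def randIter (κ a b : ℝ) (n₀ : ℕ) (f : Plane → Plane) (ω : ℕ → Set.Ici n₀) :
    ℕ → Plane → Plane
  | 0 => id
  | n + 1 => (impulse κ a b n₀ (ω n : ℕ) ∘ f) ∘ randIter κ a b n₀ f ω n

/-- The Bernoulli measure on `{n | n ≥ n₀}^ℕ` whose one-dimensional marginals have weights `p`. -/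
def bernoulliMeasure {n₀ : ℕ} (p : PMF (Set.Ici n₀)) : Measure (ℕ → Set.Ici n₀) :=
  Measure.infinitePi (fun _ : ℕ => p.toMeasure)

/-- The maps `F n`, restricted to the set `s`, have Lyapunov exponent `c` at `z` in direction `v`:
all of them are differentiable at `z` within `s`, none of the derivatives `D(F n)(z)` annihilates
`v`, and `(1/n) log ‖D(F n)(z) v‖ → c`. -/
def HasLyapunovExponentWithin (F : ℕ → Plane → Plane) (s : Set Plane) (z v : Plane) (c : ℝ) :
    Prop :=
  (∀ n, DifferentiableWithinAt ℝ (F n) s z) ∧ (∀ n, fderivWithin ℝ (F n) s z v ≠ 0) ∧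
    Tendsto (fun n : ℕ => (1 / (n : ℝ)) * Real.log ‖fderivWithin ℝ (F n) s z v‖) atTop (𝓝 c)

/-- The Lyapunov irregular set: the points `z` at which, for some nonzero vector `v`, the Lyapunov
exponent does not exist (derivatives are the ordinary ones in the plane; a point at which some
`F n` fails to be differentiable counts as irregular). -/
def lyapunovIrregularSet (F : ℕ → Plane → Plane) : Set Plane :=
  {z | ∃ v : Plane, v ≠ 0 ∧ ¬ ∃ c : ℝ, HasLyapunovExponentWithin F univ z v c}

end FigureEight

end

namespace FigureEight

/-! ### Itineraries through the boxes and the rescaled return map. -/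

section Dynamics

variable {κ a b : ℝ} {n₀ k₀ : ℕ} {f : Plane ≃ Plane}

/-! In rescaled coordinates `(x, κ^j y)` every box `S_j` becomes `I × I`, and return to the boxes
followed by a kick is exactly the rotation `rot`, an isometry preserving that square
(`impulse_return`). Kicks act only at returns, and the first return from `S_j` takes time `j + k₀`
(`iterate_notMem_of_lt`). So on `S_m` the map `f_ω^n` is an isometry, up to rescaling, into the last
box visited `S_j`, followed by `f^l` with `l < j + k₀` (`randIter_eq`).

Since `Df` and its inverse are uniformly bounded, `log ‖Df_ω^n v‖` stays within `O(j + 1)` of a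
constant depending only on `m` and `v`, where `j` is `m` or some `ω t` with `t < n`. Finite mean and
Borel–Cantelli make `ω t = o(t)` almost surely, so all exponents vanish. Irregular points can then
lie only on the box boundaries, which are null. -/

theorem saddle_iterate_apply_zero (κ : ℝ) (l : ℕ) (q : Plane) :
    ((saddle κ)^[l] q) 0 = (κ ^ (-2 : ℤ)) ^ l * q 0 := by
  induction l with
  | zero => simp
  | succ l ih =>
    rw [Function.iterate_succ_apply']
    simp only [saddle, PiLp.toLp_apply, Matrix.cons_val_zero] at ih ⊢
    rw [ih, pow_succ']
    ring

theorem IsFigureEightDiffeo.iterate_eq_saddle (hf : IsFigureEightDiffeo κ a b n₀ k₀ f)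
    {j : ℕ} (hj : n₀ ≤ j) {q : Plane} (hq : q ∈ boxS κ a b j) {l : ℕ} (hl : l ≤ j) :
    f^[l] q = (saddle κ)^[l] q := by
  obtain ⟨V, -, hV, hfV⟩ := hf.local_linear
  induction l with
  | zero => rfl
  | succ l ih =>
    rw [Function.iterate_succ_apply', Function.iterate_succ_apply', ← ih (by omega)]
    exact hfV _ (hV j hj l (by omega) ⟨q, hq, rfl⟩)

/-- While an orbit starting in `S_j` follows the linear saddle it meets no box. -/
theorem IsFigureEightDiffeo.iterate_notMem_of_le (hf : IsFigureEightDiffeo κ a b n₀ k₀ f)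
    (ha : 1 < a) (hb : b < κ) {j : ℕ} (hj : n₀ ≤ j) {q : Plane} (hq : q ∈ boxS κ a b j)
    {l : ℕ} (hl0 : 0 < l) (hl : l ≤ j) (n : ℕ) : f^[l] q ∉ boxS κ a b n := by
  intro h
  have hx := h.1.1
  have hqb := hq.1.2
  have hqa := hq.1.1
  rw [hf.iterate_eq_saddle hj hq hl, saddle_iterate_apply_zero] at hx
  have hκ : 1 < κ := by linarith
  have hc0 : 0 < κ ^ (-2 : ℤ) := by positivity
  -- One saddle step already brings the first coordinate, at most `b < κ`, below `1 < a`.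
  have hc : κ ^ (-2 : ℤ) * κ ≤ 1 := by
    rw [← zpow_add_one₀ (by positivity)]
    exact zpow_le_one_of_nonpos₀ hκ.le (by norm_num)
  have hc1 : κ ^ (-2 : ℤ) ≤ 1 := zpow_le_one_of_nonpos₀ hκ.le (by norm_num)
  have hpow : (κ ^ (-2 : ℤ)) ^ l ≤ κ ^ (-2 : ℤ) := by
    simpa using pow_le_pow_of_le_one hc0.le hc1 (Nat.one_le_iff_ne_zero.2 hl0.ne')
  have h1 : (κ ^ (-2 : ℤ)) ^ l * q 0 ≤ κ ^ (-2 : ℤ) * κ :=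
    mul_le_mul hpow (by linarith) (by linarith) hc0.le
  linarith

/-- The first return of a point of `S_j` to the union of the boxes happens at time `j + k₀`. -/
theorem IsFigureEightDiffeo.iterate_notMem_of_lt (hf : IsFigureEightDiffeo κ a b n₀ k₀ f)
    (ha : 1 < a) (hb : b < κ) {j : ℕ} (hj : n₀ ≤ j) {q : Plane} (hq : q ∈ boxS κ a b j)
    {l : ℕ} (hl0 : 0 < l) (hl : l < j + k₀) {n : ℕ} (hn : n₀ ≤ n) :
    f^[l] q ∉ boxS κ a b n := by
  -- A premature visit to `S_n` forces `n < k₀` and yields another to `S_{2n}`, on an orbit from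
  -- `S_{2j}`. The index cannot double forever.
  induction hd : k₀ - n using Nat.strong_induction_on generalizing j q l n with
  | _ d ih =>
    intro h
    have hn₀ := hf.n₀_pos
    have hjl : j < l := by
      by_contra! hle
      exact hf.iterate_notMem_of_le ha hb hj hq hl0 hle n h
    have hq' := (hf.transition j hj q hq).2
    have h' := (hf.transition n hn _ h).2
    -- Otherwise the arrival in `S_{2j}` at time `j + k₀` would fall within the saddle passage that
    -- starts in `S_n` at time `l`.
    have hnl : n < j + k₀ - l := by
      by_contra! hle
      refine hf.iterate_notMem_of_le ha hb hn h (l := j + k₀ - l) (by omega) hle (2 * j) ?_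
      rwa [← Function.iterate_add_apply, Nat.sub_add_cancel hl.le]
    refine ih (k₀ - 2 * n) (by omega) (j := 2 * j) (by omega) hq' (l := l + n - j)
      (by omega) (by omega) (n := 2 * n) (by omega) rfl ?_
    rw [← Function.iterate_add_apply] at h' ⊢
    rwa [show l + n - j + (j + k₀) = n + k₀ + l by omega]

theorem impulse_of_forall_notMem {j : ℕ} {p : Plane}
    (h : ∀ n, n₀ ≤ n → p ∉ boxS κ a b n) : impulse κ a b n₀ j p = p :=
  dif_neg fun ⟨n, hn, hp⟩ => h n hn hp

/-- The linear map `(x, y) ↦ (x, κ ^ t y)`. -/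
noncomputable def vertScale (κ : ℝ) (t : ℤ) : Plane →L[ℝ] Plane :=
  LinearMap.toContinuousLinearMap
    { toFun := fun p => !₂[p 0, κ ^ t * p 1]
      map_add' := fun p q => by ext i; fin_cases i <;> simp [mul_add]
      map_smul' := fun c p => by ext i; fin_cases i <;> simp [mul_left_comm] }

theorem vertScale_apply (κ : ℝ) (t : ℤ) (p : Plane) :
    vertScale κ t p = !₂[p 0, κ ^ t * p 1] := rfl

theorem vertScale_vertScale_neg (hκ : 0 < κ) (t : ℤ) (p : Plane) :
    vertScale κ t (vertScale κ (-t) p) = p := by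
  have : κ ^ t ≠ 0 := by positivity
  ext i; fin_cases i <;> simp [vertScale_apply, zpow_neg, this]

theorem norm_sq_vertScale (κ : ℝ) (t : ℤ) (p : Plane) :
    ‖vertScale κ t p‖ ^ 2 = p 0 ^ 2 + (κ ^ t * p 1) ^ 2 := by
  simp [EuclideanSpace.norm_sq_eq, vertScale_apply]

/-- Together with `norm_vertScale_le`, this shows that passing between rescaled and original
coordinates on `S_n` costs a factor of at most `κ ^ n`. -/
theorem norm_le_norm_vertScale (hκ : 1 ≤ κ) (n : ℕ) (p : Plane) :
    ‖p‖ ≤ ‖vertScale κ n p‖ := by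
  refine le_of_sq_le_sq ?_ (norm_nonneg _)
  rw [norm_sq_vertScale, EuclideanSpace.norm_sq_eq, Fin.sum_univ_two, mul_pow, zpow_natCast]
  have : 1 ≤ (κ ^ n) ^ 2 := one_le_pow₀ (one_le_pow₀ hκ)
  simp only [Real.norm_eq_abs, sq_abs]
  nlinarith [sq_nonneg (p 1)]

theorem norm_vertScale_le (hκ : 1 ≤ κ) (n : ℕ) (p : Plane) :
    ‖vertScale κ n p‖ ≤ κ ^ n * ‖p‖ := by
  refine le_of_sq_le_sq ?_ (by positivity)
  rw [norm_sq_vertScale, mul_pow (κ ^ n), EuclideanSpace.norm_sq_eq, Fin.sum_univ_two, mul_pow,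
    zpow_natCast]
  have : 1 ≤ (κ ^ n) ^ 2 := one_le_pow₀ (one_le_pow₀ hκ)
  simp only [Real.norm_eq_abs, sq_abs]
  nlinarith [sq_nonneg (p 0)]

/-- The linear part of the rotation `rot a b`. -/
noncomputable def quarterTurn : Plane →L[ℝ] Plane :=
  LinearMap.toContinuousLinearMap
    { toFun := fun p => !₂[-p 1, p 0]
      map_add' := fun p q => by ext i; fin_cases i <;> simp [add_comm]
      map_smul' := fun c p => by ext i; fin_cases i <;> simp }

theorem norm_quarterTurn (p : Plane) : ‖quarterTurn p‖ = ‖p‖ := by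
  refine (sq_eq_sq₀ (norm_nonneg _) (norm_nonneg _)).1 ?_
  simp [EuclideanSpace.norm_sq_eq, quarterTurn, add_comm]

theorem rot_eq (a b : ℝ) (p : Plane) : rot a b p = !₂[a + b, 0] + quarterTurn p := by
  ext i; fin_cases i <;> simp [rot, quarterTurn, sub_eq_add_neg]

theorem hasFDerivAt_rot (a b : ℝ) (p : Plane) : HasFDerivAt (rot a b) quarterTurn p := by
  rw [show rot a b = fun p => !₂[a + b, 0] + quarterTurn p from funext (rot_eq a b)]
  exact quarterTurn.hasFDerivAt.const_add _

/-- In rescaled coordinates the kicked return map from `S_j` to `S_i` is the rotation. -/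
theorem IsFigureEightDiffeo.impulse_return (hf : IsFigureEightDiffeo κ a b n₀ k₀ f)
    (ha : 1 < a) (hab : a < b) (hb : b < κ) {j : ℕ} (hj : n₀ ≤ j) {q : Plane}
    (hq : q ∈ boxS κ a b j) (i : ℕ) :
    impulse κ a b n₀ i (f^[j + k₀] q) = vertScale κ (-i) (rot a b (vertScale κ j q)) ∧
      vertScale κ (-i) (rot a b (vertScale κ j q)) ∈ boxS κ a b i := by
  have hκ : 0 < κ := by linarith
  obtain ⟨he, hmem⟩ := hf.transition j hj q hq
  constructor
  · rw [impulse_of_mem ha hb i (by omega) hmem, he]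
    ext k; fin_cases k
    · simp [vertScale_apply, rot]
    · have h : κ ^ (((2 * j : ℕ) : ℤ) - (i : ℤ)) * κ ^ (-(2 * j : ℤ)) = κ ^ (-(i : ℤ)) := by
        rw [← zpow_add₀ hκ.ne']; congr 1; push_cast; ring
      simp only [vertScale_apply, rot, PiLp.toLp_apply, Fin.mk_one, Matrix.cons_val_one,
        Matrix.cons_val_zero, Matrix.cons_val_fin_one]
      rw [← mul_assoc, h]
  · obtain ⟨⟨h1, h2⟩, h3, h4⟩ := hq
    have hκj : 0 < κ ^ j := by positivity
    have hκi : 0 < κ ^ (-(i : ℤ)) := by positivity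
    have hz : κ ^ j * κ ^ (-(j : ℤ)) = 1 := by
      rw [zpow_neg, zpow_natCast]; exact mul_inv_cancel₀ hκj.ne'
    have h5 := mul_le_mul_of_nonneg_left h3 hκj.le
    have h6 := mul_le_mul_of_nonneg_left h4 hκj.le
    rw [← mul_assoc, hz, one_mul] at h5 h6
    have h7 := mul_le_mul_of_nonneg_left h1 hκi.le
    have h8 := mul_le_mul_of_nonneg_left h2 hκi.le
    refine ⟨⟨?_, ?_⟩, ?_, ?_⟩ <;> simp [vertScale_apply, rot] at * <;> linarith

/-- On `S_m`, the map `f_ω^n` is `f^l` following an affine map `A` into the box `S_j` visited last;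
the linear part of `A` is an isometry in rescaled coordinates. -/
theorem IsFigureEightDiffeo.randIter_eq (hf : IsFigureEightDiffeo κ a b n₀ k₀ f)
    (ha : 1 < a) (hab : a < b) (hb : b < κ) (ω : ℕ → Set.Ici n₀) {m : ℕ} (hm : n₀ ≤ m) (n : ℕ) :
    ∃ (j l : ℕ) (A : Plane → Plane) (L : Plane →L[ℝ] Plane),
      n₀ ≤ j ∧ l < j + k₀ ∧ (j = m ∨ ∃ t < n, j = ω t) ∧
      (∀ z, HasFDerivAt A L z) ∧ (∀ v, ‖vertScale κ j (L v)‖ = ‖vertScale κ m v‖) ∧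
      MapsTo A (boxS κ a b m) (boxS κ a b j) ∧
      EqOn (randIter κ a b n₀ f ω n) (f^[l] ∘ A) (boxS κ a b m) := by
  have hκ : 0 < κ := by linarith
  induction n with
  | zero =>
    refine ⟨m, 0, id, .id ℝ _, hm, ?_, .inl rfl, fun z => hasFDerivAt_id z, fun v => rfl,
      mapsTo_id _, fun z _ => rfl⟩
    have := hf.k₀_pos
    omega
  | succ n ih =>
    obtain ⟨j, l, A, L, hj, hl, hjω, hA, hL, hmaps, heq⟩ := ih
    have hstep : ∀ z ∈ boxS κ a b m, randIter κ a b n₀ f ω (n + 1) z =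
        impulse κ a b n₀ (ω n : ℕ) (f^[l + 1] (A z)) := by
      intro z hz
      rw [Function.iterate_succ_apply']
      exact congrArg (fun w => impulse κ a b n₀ (ω n : ℕ) (f w)) (heq hz)
    rcases Nat.lt_or_ge (l + 1) (j + k₀) with hlt | hge
    · refine ⟨j, l + 1, A, L, hj, hlt, ?_, hA, hL, hmaps, fun z hz => ?_⟩
      · exact hjω.imp_right fun ⟨t, ht, h⟩ => ⟨t, by omega, h⟩
      · rw [hstep z hz]
        exact impulse_of_forall_notMem fun i hi =>
          hf.iterate_notMem_of_lt ha hb hj (hmaps hz) l.succ_pos hlt hi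
    · have hl1 : l + 1 = j + k₀ := by omega
      refine ⟨(ω n : ℕ), 0,
        fun z => vertScale κ (-((ω n : ℕ) : ℤ)) (rot a b (vertScale κ j (A z))),
        (vertScale κ (-((ω n : ℕ) : ℤ))).comp (quarterTurn.comp ((vertScale κ j).comp L)),
        (ω n).2, ?_, .inr ⟨n, n.lt_succ_self, rfl⟩, fun z => ?_, fun v => ?_,
        fun z hz => ?_, fun z hz => ?_⟩
      · have := hf.k₀_pos
        omega
      · exact (vertScale κ _).hasFDerivAt.comp z ((hasFDerivAt_rot a b _).comp z
          ((vertScale κ _).hasFDerivAt.comp z (hA z)))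
      · simp only [ContinuousLinearMap.comp_apply]
        rw [vertScale_vertScale_neg hκ, norm_quarterTurn, hL]
      · exact (hf.impulse_return ha hab hb hj (hmaps hz) _).2
      · rw [hstep z hz, hl1]
        exact (hf.impulse_return ha hab hb hj (hmaps hz) _).1

end Dynamics

/-! ### Uniform bounds on the derivatives of the iterates of `f`. -/

section Derivative

/-- A `C¹` map which is the identity off a ball has bounded derivative. -/
theorem exists_norm_fderiv_le {E : Type*} [NormedAddCommGroup E] [NormedSpace ℝ E] [ProperSpace E]
    {g : E → E} (hg : ContDiff ℝ 1 g) {r : ℝ} (hr : ∀ p, r ≤ ‖p‖ → g p = p) :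
    ∃ C : ℝ, ∀ p, ‖fderiv ℝ g p‖ ≤ C := by
  have hc : Continuous (fderiv ℝ g) := hg.continuous_fderiv one_ne_zero
  obtain ⟨C, hC⟩ := (isCompact_closedBall (0 : E) r).exists_bound_of_continuousOn hc.continuousOn
  refine ⟨max C 1, fun p => ?_⟩
  rcases le_or_gt ‖p‖ r with h | h
  · exact (hC p (by simpa using h)).trans (le_max_left _ _)
  · have hev : g =ᶠ[𝓝 p] id := by
      filter_upwards [(isOpen_lt continuous_const continuous_norm).mem_nhds h] with q hq
      exact hr q (le_of_lt hq)
    rw [hev.fderiv_eq, fderiv_id]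
    exact ContinuousLinearMap.norm_id_le.trans (le_max_right _ _)

theorem IsFigureEightDiffeo.exists_fderiv_iterate_bounds {κ a b : ℝ} {n₀ k₀ : ℕ}
    {f : Plane ≃ Plane} (hf : IsFigureEightDiffeo κ a b n₀ k₀ f) :
    ∃ C : ℝ, 1 ≤ C ∧ ∀ (l : ℕ) (p w : Plane),
      ‖fderiv ℝ f^[l] p w‖ ≤ C ^ l * ‖w‖ ∧ ‖w‖ ≤ C ^ l * ‖fderiv ℝ f^[l] p w‖ := by
  obtain ⟨r, hr⟩ := hf.compactly_supported
  have h1 : ContDiff ℝ 1 f := hf.contDiff.of_le (by exact_mod_cast le_top)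
  have h2 : ContDiff ℝ 1 f.symm := hf.contDiff_symm.of_le (by exact_mod_cast le_top)
  obtain ⟨C₁, hC₁⟩ := exists_norm_fderiv_le h1 hr
  obtain ⟨C₂, hC₂⟩ := exists_norm_fderiv_le h2 (r := r)
    fun p hp => (f.symm_apply_eq).2 (hr p hp).symm
  have hd : Differentiable ℝ f := h1.differentiable one_ne_zero
  have hd' : Differentiable ℝ f.symm := h2.differentiable one_ne_zero
  set C := max 1 (max C₁ C₂)
  have hC1 : 1 ≤ C := le_max_left _ _
  have hup : ∀ p w, ‖fderiv ℝ f p w‖ ≤ C * ‖w‖ := fun p w =>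
    (fderiv ℝ f p).le_of_opNorm_le
      ((hC₁ p).trans ((le_max_left _ _).trans (le_max_right _ _))) w
  have hlow : ∀ p w, ‖w‖ ≤ C * ‖fderiv ℝ f p w‖ := fun p w => by
    have hcomp : (fderiv ℝ f.symm (f p)).comp (fderiv ℝ f p) = .id ℝ _ := by
      rw [← fderiv_comp p (hd' _) (hd p), f.symm_comp_self, fderiv_id]
    calc ‖w‖ = ‖fderiv ℝ f.symm (f p) (fderiv ℝ f p w)‖ := by
          rw [← ContinuousLinearMap.comp_apply, hcomp]; rfl
      _ ≤ _ := (fderiv ℝ f.symm (f p)).le_of_opNorm_le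
          ((hC₂ _).trans ((le_max_right _ _).trans (le_max_right _ _))) _
  refine ⟨C, hC1, fun l => ?_⟩
  induction l with
  | zero => intro p w; simp
  | succ l ih =>
    intro p w
    have hcomp : fderiv ℝ f^[l + 1] p w = fderiv ℝ f (f^[l] p) (fderiv ℝ f^[l] p w) := by
      rw [Function.iterate_succ', fderiv_comp p (hd _) (hd.iterate l p)]; rfl
    rw [hcomp, pow_succ]
    have hC0 : 0 ≤ C ^ l := by positivity
    constructor
    · calc _ ≤ C * ‖fderiv ℝ f^[l] p w‖ := hup _ _
        _ ≤ C * (C ^ l * ‖w‖) := by gcongr; exact (ih p w).1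
        _ = _ := by ring
    · calc _ ≤ C ^ l * ‖fderiv ℝ f^[l] p w‖ := (ih p w).2
        _ ≤ C ^ l * (C * ‖fderiv ℝ f (f^[l] p) (fderiv ℝ f^[l] p w)‖) := by
          gcongr; exact hlow _ _
        _ = _ := by ring

end Derivative

/-! ### Geometry of the boxes. -/

section Box

variable {κ a b : ℝ}

theorem convex_boxS (κ a b : ℝ) (n : ℕ) : Convex ℝ (boxS κ a b n) := by
  have h (i : Fin 2) (c d : ℝ) : Convex ℝ {p : Plane | p i ∈ Icc c d} :=
    (convex_Icc c d).linear_preimage (EuclideanSpace.proj i : Plane →L[ℝ] ℝ).toLinearMap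
  exact (h 0 _ _).inter (h 1 _ _)

theorem interior_boxS_nonempty (hab : a < b) (hκ : 0 < κ) (n : ℕ) :
    (interior (boxS κ a b n)).Nonempty := by
  have hκn : 0 < κ ^ (-(n : ℤ)) := by positivity
  obtain ⟨x, hx⟩ := exists_between hab
  obtain ⟨y, hy⟩ := exists_between (mul_lt_mul_of_pos_left hab hκn)
  have ho (i : Fin 2) (c d : ℝ) : IsOpen {p : Plane | p i ∈ Ioo c d} :=
    isOpen_Ioo.preimage (EuclideanSpace.proj i : Plane →L[ℝ] ℝ).continuous
  refine ⟨!₂[x, y], interior_maximal (fun p hp => ?_)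
    ((ho 0 a b).inter (ho 1 (κ ^ (-(n : ℤ)) * a) (κ ^ (-(n : ℤ)) * b))) ⟨hx, hy⟩⟩
  exact ⟨Ioo_subset_Icc_self hp.1, Ioo_subset_Icc_self hp.2⟩

theorem uniqueDiffOn_boxS (hab : a < b) (hκ : 0 < κ) (n : ℕ) :
    UniqueDiffOn ℝ (boxS κ a b n) :=
  uniqueDiffOn_convex (convex_boxS κ a b n) (interior_boxS_nonempty hab hκ n)

theorem volume_frontier_boxS (κ a b : ℝ) (n : ℕ) : volume (frontier (boxS κ a b n)) = 0 :=
  (convex_boxS κ a b n).addHaar_frontier volume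

end Box

/-! ### Sublinear growth of the kicks. -/

section Probability

/-- First-moment Borel–Cantelli: the coordinates grow sublinearly almost surely. -/
theorem ae_eventually_mul_lt {n₀ : ℕ} (p : PMF (Set.Ici n₀))
    (hp : ∑' n : Set.Ici n₀, ((n : ℕ) : ℝ≥0∞) * p n < ⊤) :
    ∀ᵐ ω ∂(bernoulliMeasure p), ∀ K : ℕ, ∀ᶠ k in atTop, K * (ω k : ℕ) < k := by
  rw [ae_all_iff]
  intro K
  have hprob (k : ℕ) : bernoulliMeasure p {ω | k ≤ K * (ω k : ℕ)} =
      ∑' n : Set.Ici n₀, if k ≤ K * (n : ℕ) then p n else 0 := by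
    have hs : MeasurableSet {n : Set.Ici n₀ | k ≤ K * (n : ℕ)} := .of_discrete
    have := (measurePreserving_eval_infinitePi (fun _ : ℕ => p.toMeasure) k).measure_preimage
      hs.nullMeasurableSet
    rw [bernoulliMeasure, show {ω : ℕ → Set.Ici n₀ | k ≤ K * (ω k : ℕ)} =
      Function.eval k ⁻¹' {n : Set.Ici n₀ | k ≤ K * (n : ℕ)} from rfl, this,
      p.toMeasure_apply (hs := hs)]
    simp [Set.indicator_apply]
  -- Exactly `K * n + 1` values of `k` contribute, so after exchanging the sums the total
  -- probability is `K` times the mean plus one.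
  have hcount (n : Set.Ici n₀) : ∑' k : ℕ, (if k ≤ K * (n : ℕ) then p n else 0) =
      K * ((n : ℕ) * p n) + p n := by
    rw [tsum_eq_sum (s := Finset.range (K * (n : ℕ) + 1))]
    · rw [Finset.sum_congr rfl fun k hk => if_pos (Nat.lt_succ_iff.1 (Finset.mem_range.1 hk))]
      simp only [Finset.sum_const, Finset.card_range, nsmul_eq_mul]
      push_cast
      ring
    · intro k hk
      exact if_neg fun h => hk (Finset.mem_range.2 (Nat.lt_succ_iff.2 h))
  have hsum : ∑' k, bernoulliMeasure p {ω | k ≤ K * (ω k : ℕ)} ≠ ⊤ := by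
    simp_rw [hprob]
    rw [ENNReal.tsum_comm]
    simp_rw [hcount]
    rw [ENNReal.tsum_add, ENNReal.tsum_mul_left, p.tsum_coe]
    exact ENNReal.add_ne_top.2
      ⟨ENNReal.mul_ne_top (ENNReal.natCast_ne_top K) hp.ne, ENNReal.one_ne_top⟩
  filter_upwards [ae_eventually_notMem hsum] with ω hω
  filter_upwards [hω] with k hk
  simpa using hk

end Probability

/-! ### Vanishing of the exponents. -/

section Exponent

theorem abs_log_sub_log_le {x y C : ℝ} (hx : 0 < x) (hy : 0 < y) (hC : 0 < C)
    (h₁ : x ≤ C * y) (h₂ : y ≤ C * x) : |Real.log x - Real.log y| ≤ Real.log C := by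
  have h₁' := Real.log_le_log hx h₁
  have h₂' := Real.log_le_log hy h₂
  rw [Real.log_mul hC.ne' hy.ne'] at h₁'
  rw [Real.log_mul hC.ne' hx.ne'] at h₂'
  exact abs_le.2 ⟨by linarith, by linarith⟩

/-- The last kick before time `n` may have any index `t < n`, so a bound for every index is needed;
`M` absorbs the finitely many exceptions. -/
theorem exists_mul_le_add {n₀ : ℕ} {ω : ℕ → Set.Ici n₀} {K : ℕ}
    (h : ∀ᶠ k in atTop, K * (ω k : ℕ) < k) : ∃ M : ℕ, ∀ k, K * (ω k : ℕ) ≤ M + k := by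
  obtain ⟨N, hN⟩ := eventually_atTop.1 h
  refine ⟨∑ k ∈ Finset.range N, K * (ω k : ℕ), fun k => ?_⟩
  rcases Nat.lt_or_ge k N with hk | hk
  · exact (Finset.single_le_sum (f := fun k => K * (ω k : ℕ)) (fun _ _ => Nat.zero_le _)
      (Finset.mem_range.2 hk)).trans (Nat.le_add_right _ _)
  · exact (hN k hk).le.trans (Nat.le_add_left _ _)

/-- A sequence bounded by `D + B j n` with `j` sublinear is sublinear. -/
theorem tendsto_div_zero_of_sublinear {u : ℕ → ℝ} {j : ℕ → ℕ} {D B : ℝ} (hB : 0 ≤ B)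
    (hu : ∀ n, |u n| ≤ D + B * j n) (hj : ∀ K : ℕ, ∃ M : ℕ, ∀ n, K * j n ≤ M + n) :
    Tendsto (fun n : ℕ => (1 / (n : ℝ)) * u n) atTop (𝓝 0) := by
  rw [Metric.tendsto_atTop]
  intro ε hε
  -- `K` makes the linear part of the bound less than `ε n / 2`; `N` below does the same for the
  -- constant part.
  obtain ⟨K, hK⟩ := exists_nat_gt (2 * B / ε)
  have hK0 : (0 : ℝ) < K := lt_of_le_of_lt (by positivity) hK
  obtain ⟨M, hM⟩ := hj K
  obtain ⟨N, hN⟩ := exists_nat_gt (2 * (D + B * M / K) / ε)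
  refine ⟨N + 1, fun n hn => ?_⟩
  have hnN : (N : ℝ) + 1 ≤ n := by exact_mod_cast hn
  have hn0 : (0 : ℝ) < n := lt_of_lt_of_le (by positivity) hnN
  have hMn : (K : ℝ) * j n ≤ M + n := by exact_mod_cast hM n
  have hjn : (j n : ℝ) ≤ (M + n) / K := by rwa [le_div_iff₀ hK0, mul_comm]
  have hBK : B / K < ε / 2 := by
    rw [div_lt_iff₀ hε] at hK
    rw [div_lt_iff₀ hK0]
    linarith
  rw [div_lt_iff₀ hε] at hN
  have hu' : |u n| ≤ D + B * M / K + B / K * n :=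
    calc |u n| ≤ D + B * j n := hu n
      _ ≤ D + B * ((M + n) / K) := by gcongr
      _ = _ := by ring
  have h1 : B / K * n < ε / 2 * n := mul_lt_mul_of_pos_right hBK hn0
  have h2 : (N : ℝ) * ε ≤ n * ε := by gcongr; linarith
  rw [Real.dist_eq, sub_zero, abs_mul, abs_of_pos (by positivity), one_div, inv_mul_lt_iff₀ hn0]
  linarith

variable {κ a b : ℝ} {n₀ k₀ : ℕ} {f : Plane ≃ Plane}

/-- The factor `C ^ (j + k₀)` pays for the unfinished excursion `f^l`, and `κ ^ j` for undoing the
rescaling on `S_j`. Nothing accumulates from earlier returns. -/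
theorem IsFigureEightDiffeo.fderivWithin_randIter_bounds
    (hf : IsFigureEightDiffeo κ a b n₀ k₀ f) (ha : 1 < a) (hab : a < b) (hb : b < κ)
    {C : ℝ} (hC : 1 ≤ C)
    (hfC : ∀ (l : ℕ) (p w : Plane),
      ‖fderiv ℝ f^[l] p w‖ ≤ C ^ l * ‖w‖ ∧ ‖w‖ ≤ C ^ l * ‖fderiv ℝ f^[l] p w‖)
    (ω : ℕ → Set.Ici n₀) {m : ℕ} (hm : n₀ ≤ m) {z : Plane} (hz : z ∈ boxS κ a b m) (n : ℕ) :
    DifferentiableWithinAt ℝ (randIter κ a b n₀ f ω n) (boxS κ a b m) z ∧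
      ∃ j : ℕ, (j = m ∨ ∃ t < n, j = ω t) ∧ ∀ v : Plane, v ≠ 0 →
        fderivWithin ℝ (randIter κ a b n₀ f ω n) (boxS κ a b m) z v ≠ 0 ∧
        |Real.log ‖fderivWithin ℝ (randIter κ a b n₀ f ω n) (boxS κ a b m) z v‖ -
          Real.log ‖vertScale κ m v‖| ≤ Real.log (C ^ (j + k₀) * κ ^ j) := by
  have hκ : 1 ≤ κ := by linarith
  obtain ⟨j, l, A, L, -, hl, hjω, hA, hL, -, heq⟩ := hf.randIter_eq ha hab hb ω hm n
  have hd : Differentiable ℝ f^[l] :=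
    (hf.contDiff.differentiable (by simp)).iterate l
  have hder : HasFDerivWithinAt (randIter κ a b n₀ f ω n) ((fderiv ℝ f^[l] (A z)).comp L)
      (boxS κ a b m) z :=
    (((hd (A z)).hasFDerivAt.comp z (hA z)).hasFDerivWithinAt).congr heq (heq hz)
  refine ⟨hder.differentiableWithinAt, j, hjω, fun v hv => ?_⟩
  rw [hder.fderivWithin (uniqueDiffOn_boxS hab (by linarith) m z hz),
    ContinuousLinearMap.comp_apply]
  obtain ⟨hup, hlow⟩ := hfC l (A z) (L v)
  have hw₁ : ‖L v‖ ≤ ‖vertScale κ m v‖ := hL v ▸ norm_le_norm_vertScale hκ j (L v)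
  have hw₂ : ‖vertScale κ m v‖ ≤ κ ^ j * ‖L v‖ := hL v ▸ norm_vertScale_le hκ j (L v)
  have hs : 0 < ‖vertScale κ m v‖ := (norm_pos_iff.2 hv).trans_le (norm_le_norm_vertScale hκ m v)
  have hκj : 1 ≤ κ ^ j := one_le_pow₀ hκ
  have hCl : C ^ l ≤ C ^ (j + k₀) := pow_le_pow_right₀ hC hl.le
  have hlow' : ‖vertScale κ m v‖ ≤ C ^ (j + k₀) * κ ^ j * ‖fderiv ℝ f^[l] (A z) (L v)‖ :=
    calc _ ≤ κ ^ j * ‖L v‖ := hw₂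
      _ ≤ κ ^ j * (C ^ l * ‖fderiv ℝ f^[l] (A z) (L v)‖) := by gcongr
      _ ≤ κ ^ j * (C ^ (j + k₀) * ‖fderiv ℝ f^[l] (A z) (L v)‖) := by gcongr
      _ = _ := by ring
  have hup' : ‖fderiv ℝ f^[l] (A z) (L v)‖ ≤ C ^ (j + k₀) * κ ^ j * ‖vertScale κ m v‖ :=
    calc _ ≤ C ^ l * ‖L v‖ := hup
      _ ≤ C ^ (j + k₀) * ‖vertScale κ m v‖ := by gcongr
      _ ≤ C ^ (j + k₀) * κ ^ j * ‖vertScale κ m v‖ := by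
        gcongr; exact le_mul_of_one_le_right (by positivity) hκj
  have hne : fderiv ℝ f^[l] (A z) (L v) ≠ 0 := by
    intro h
    rw [h, norm_zero, mul_zero] at hlow'
    exact hs.not_ge hlow'
  exact ⟨hne, abs_log_sub_log_le (norm_pos_iff.2 hne) hs (by positivity) hup' hlow'⟩

/-- If the kicks grow sublinearly, all Lyapunov exponents on the boxes vanish. -/
theorem IsFigureEightDiffeo.hasLyapunovExponentWithin
    (hf : IsFigureEightDiffeo κ a b n₀ k₀ f) (ha : 1 < a) (hab : a < b) (hb : b < κ)
    {ω : ℕ → Set.Ici n₀} (hω : ∀ K : ℕ, ∀ᶠ k in atTop, K * (ω k : ℕ) < k)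
    {m : ℕ} (hm : n₀ ≤ m) {z : Plane} (hz : z ∈ boxS κ a b m) {v : Plane} (hv : v ≠ 0) :
    HasLyapunovExponentWithin (randIter κ a b n₀ f ω) (boxS κ a b m) z v 0 := by
  obtain ⟨C, hC, hfC⟩ := hf.exists_fderiv_iterate_bounds
  have hκ : 1 ≤ κ := by linarith
  choose hd j hj hbd using fun n => hf.fderivWithin_randIter_bounds ha hab hb hC hfC ω hm hz n
  refine ⟨hd, fun n => (hbd n v hv).1, ?_⟩
  have hC0 := Real.log_nonneg hC
  have hκ0 := Real.log_nonneg hκ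
  refine tendsto_div_zero_of_sublinear (j := j)
    (D := |Real.log ‖vertScale κ m v‖| + k₀ * Real.log C) (B := Real.log C + Real.log κ)
    (by positivity) (fun n => ?_) (fun K => ?_)
  · have h := (hbd n v hv).2
    rw [Real.log_mul (by positivity) (by positivity), Real.log_pow, Real.log_pow] at h
    push_cast at h
    have h' := (abs_sub_abs_le_abs_sub _ _).trans h
    linarith
  · obtain ⟨M, hM⟩ := exists_mul_le_add (hω K)
    refine ⟨M + K * m, fun n => ?_⟩
    rcases hj n with h | ⟨t, ht, h⟩
    · rw [h]; omega
    · rw [h]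
      have := hM t
      omega

/-- At interior points of `s`, derivatives within `s` are ordinary derivatives, so the exponents
agree. -/
theorem lyapunovIrregularSet_inter_subset {F : ℕ → Plane → Plane} {s : Set Plane}
    (h : ∀ z ∈ s, ∀ v : Plane, v ≠ 0 → ∃ c, HasLyapunovExponentWithin F s z v c) :
    lyapunovIrregularSet F ∩ s ⊆ frontier s := by
  rintro z ⟨⟨v, hv, hirr⟩, hz⟩
  refine ⟨subset_closure hz, fun hint => hirr ?_⟩
  obtain ⟨c, h₁, h₂, h₃⟩ := h z hz v hv
  have hs : s ∈ 𝓝 z := mem_interior_iff_mem_nhds.1 hint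
  simp only [fderivWithin_of_mem_nhds hs] at h₂ h₃
  refine ⟨c, fun n => ((h₁ n).differentiableAt hs).differentiableWithinAt, ?_, ?_⟩ <;>
    simpa only [fderivWithin_univ]

end Exponent

end FigureEight

theorem theorem5p2 (κ a b : ℝ) (ha : 1 < a) (hab : a < b) (hb : b < κ) (n₀ k₀ : ℕ)
    (f : FigureEight.Plane ≃ FigureEight.Plane)
    (hf : FigureEight.IsFigureEightDiffeo κ a b n₀ k₀ f)
    (p : PMF (Set.Ici n₀)) (hp : ∑' n : Set.Ici n₀, ((n : ℕ) : ℝ≥0∞) * p n < ⊤) :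
    (∀ᵐ ω ∂(FigureEight.bernoulliMeasure p), ∀ m : ℕ, n₀ ≤ m →
      ∀ z ∈ FigureEight.boxS κ a b m, ∀ v : FigureEight.Plane, v ≠ 0 →
        FigureEight.HasLyapunovExponentWithin (FigureEight.randIter κ a b n₀ f ω)
          (FigureEight.boxS κ a b m) z v 0) ∧
    (∀ᵐ ω ∂(FigureEight.bernoulliMeasure p),
      volume (FigureEight.lyapunovIrregularSet (FigureEight.randIter κ a b n₀ f ω) ∩
        ⋃ m ∈ Set.Ici n₀, FigureEight.boxS κ a b m) = 0) := by
  have hlyap : ∀ᵐ ω ∂(FigureEight.bernoulliMeasure p), ∀ m : ℕ, n₀ ≤ m →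
      ∀ z ∈ FigureEight.boxS κ a b m, ∀ v : FigureEight.Plane, v ≠ 0 →
        FigureEight.HasLyapunovExponentWithin (FigureEight.randIter κ a b n₀ f ω)
          (FigureEight.boxS κ a b m) z v 0 :=
    (FigureEight.ae_eventually_mul_lt p hp).mono fun ω hω m hm z hz v hv =>
      hf.hasLyapunovExponentWithin ha hab hb hω hm hz hv
  refine ⟨hlyap, hlyap.mono fun ω hω => ?_⟩
  rw [inter_iUnion₂, measure_biUnion_null_iff (to_countable _)]
  exact fun m hm => measure_mono_null
    (FigureEight.lyapunovIrregularSet_inter_subset fun z hz v hv => ⟨0, hω m hm z hz v hv⟩)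
    (FigureEight.volume_frontier_boxS κ a b m)
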